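/- Let $(\varphi_e)_{e\in\omega}$ be a standard listing of the partial computable functions, and let $\mathbf d$ be a Turing degree (of a set $D\subseteq\omega$). A tree is a set $T\subseteq\omega^{<\omega}$ closed under initial segments; $n$ is an index of the computable tree $T$ if $\varphi_n$ is the characteristic function of $T$ (finite sequences being coded by natural numbers). A path through $T$ is a function $p\in\omega^\omega$ all of whose finite initial segments lie in $T$, and $T$ is ill founded if it has a path. The degree $\mathbf d$ is *loquaciously high for paths* if there is a total $\mathbf d$-computable function $F:\omega\to\omega^\omega$ (that is, $(n,x)\mapsto F(n)(x)$ is total and $\mathbf d$-computable) such that, for every $n$ that is an index of an ill-founded computable tree $T$, $F(n)$ is a path through $T$. A computable structure is a structure $\mathcal M$ with universe a computable subset of $\omega$, in a computable first-order language (whose symbols are natural numbers, their kind and arity being computable), whose basic functions and relations are computable uniformly in the symbol; an index of $\mathcal M$ is a code for a triple of indices of partial computable functions that compute, respectively, the signature, the characteristic function of the universe, and the basic functions and relations. The degree $\mathbf d$ is *loquaciously high for isomorphism* if there is a total $\mathbf d$-computable function $F:\omega\times\omega\to\omega^\omega$ such that, whenever $i$ and $j$ are indices of computable structures $\mathcal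 M_i$ and $\mathcal M_j$ in the same language with $\mathcal M_i\cong\mathcal M_j$, the restriction of $F(i,j)$ to the universe of $\mathcal M_i$ is an isomorphism from $\mathcal M_i$ onto $\mathcal M_j$. Then $\mathbf d$ is loquaciously high for paths if and only if $\mathbf d$ is loquaciously high for isomorphism. -/

import Mathlib

noncomputable section

open scoped FirstOrder

namespace LoquaciousHighness

open Classical in
/-- The characteristic function of a set of natural numbers, as an oracle. -/
def charFun (D : Set ℕ) : ℕ →. ℕ := fun n => Part.some (if n ∈ D then 1 else 0)

/-- Turing equivalence of sets of natural numbers. -/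
def turingSetoid : Setoid (Set ℕ) where
  r D E := TuringEquivalent (charFun D) (charFun E)
  iseqv := TuringEquivalent.equivalence.comap charFun

/-- A Turing degree: an equivalence class of sets of natural numbers under Turing equivalence.
(Mathlib's `TuringDegree` consists of classes of *partial* functions, which is larger.) -/
abbrev Degree : Type := Quotient turingSetoid

/-- The Turing degree of a set. -/
def degreeOf (D : Set ℕ) : Degree := Quotient.mk turingSetoid D

/-- The standard listing `φ₀, φ₁, …` of the partial computable functions. -/
def phi (e : ℕ) : ℕ →. ℕ := (Denumerable.ofNat Nat.Partrec.Code e).eval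

/-- `φ_e` is (total and) the characteristic function of `A`, where the elements of the ambient
type are coded by natural numbers. -/
def Decides {α : Type} [Primcodable α] (e : ℕ) (A : Set α) : Prop :=
  ∀ a : α, (a ∈ A → phi e (Encodable.encode a) = Part.some 1) ∧
    (a ∉ A → phi e (Encodable.encode a) = Part.some 0)

/-! ### Trees and paths -/

/-- `n` is an index of the computable tree `T ⊆ ω^{<ω}`. -/
def IsTreeIndex (n : ℕ) (T : Descriptive.tree ℕ) : Prop :=
  Decides n (T : Set (List ℕ))

/-- `p` is a path through `T`: all finite initial segments of `p` are in `T`. -/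
def IsPath (T : Descriptive.tree ℕ) (p : ℕ → ℕ) : Prop :=
  ∀ k : ℕ, (List.range k).map p ∈ T

/-- The tree `T` is ill founded: it has a path. -/
def IllFounded (T : Descriptive.tree ℕ) : Prop := ∃ p : ℕ → ℕ, IsPath T p

/-- `d` is loquaciously high for paths: there is a total `d`-computable `F : ω → ω^ω` such that
`F(n)` is a path through the computable tree with index `n` whenever this tree is ill founded. -/
def LoquaciouslyHighForPaths (d : Degree) : Prop :=
  ∃ D : Set ℕ, degreeOf D = d ∧ ∃ F : ℕ → ℕ → ℕ,
    ComputableIn {charFun D} (fun q : ℕ × ℕ => F q.1 q.2) ∧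
    ∀ (n : ℕ) (T : Descriptive.tree ℕ),
      IsTreeIndex n T → IllFounded T → IsPath T (F n)

/-! ### Computable structures -/

/-- A countable signature with symbols named by natural numbers: `s k = none` if `k` is not a
symbol, `s k = some (Sum.inl m)` if `k` is an `m`-ary function symbol (a constant if `m = 0`), and
`s k = some (Sum.inr m)` if `k` is an `m`-ary relation symbol. -/
abbrev Signature : Type := ℕ → Option (ℕ ⊕ ℕ)

/-- The first-order language with the given signature. -/
def Signature.lang (s : Signature) : FirstOrder.Language.{0, 0} where
  Functions m := {k : ℕ // s k = some (Sum.inl m)}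
  Relations m := {k : ℕ // s k = some (Sum.inr m)}

/-- `i` codes a triple `(a, b, c)` witnessing that the given structure in the language with
signature `s`, whose universe is `A ⊆ ω`, is computable: `φ_a` computes the signature, `φ_b` is
the characteristic function of the universe, and `φ_c` computes, uniformly in the symbol, the
values of the basic functions and the truth values of the basic relations. -/
def IsStructureIndex (i : ℕ) (s : Signature) (A : Set ℕ) [s.lang.Structure A] : Prop :=
  ∃ a b c : ℕ, i = Nat.pair a (Nat.pair b c) ∧
    (∀ k : ℕ, phi a k = Part.some (Encodable.encode (s k))) ∧
    Decides b A ∧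
    (∀ (m : ℕ) (f : s.lang.Functions m) (x : Fin m → A),
      phi c (Encodable.encode (f.1, List.ofFn fun t => (x t : ℕ))) =
        Part.some (FirstOrder.Language.Structure.funMap f x : A).1) ∧
    (∀ (m : ℕ) (r : s.lang.Relations m) (x : Fin m → A),
      (FirstOrder.Language.Structure.RelMap r x →
        phi c (Encodable.encode (r.1, List.ofFn fun t => (x t : ℕ))) = Part.some 1) ∧
      (¬ FirstOrder.Language.Structure.RelMap r x →
        phi c (Encodable.encode (r.1, List.ofFn fun t => (x t : ℕ))) = Part.some 0))

/-- `d` is loquaciously high for isomorphism: there is a total `d`-computable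
`F : ω × ω → ω^ω` such that, whenever `i` and `j` are indices of isomorphic computable structures
(in the same, arbitrary computable language), `F(i, j)` restricts to an isomorphism from the
structure with index `i` onto the one with index `j`. -/
def LoquaciouslyHighForIsomorphism (d : Degree) : Prop :=
  ∃ D : Set ℕ, degreeOf D = d ∧ ∃ F : ℕ → ℕ → ℕ → ℕ,
    ComputableIn {charFun D} (fun q : ℕ × ℕ × ℕ => F q.1 q.2.1 q.2.2) ∧
    ∀ (i j : ℕ) (s : Signature) (A B : Set ℕ) [s.lang.Structure A] [s.lang.Structure B],
      IsStructureIndex i s A → IsStructureIndex j s B → Nonempty (A ≃[s.lang] B) →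
        ∃ g : A ≃[s.lang] B, ∀ x : A, (g x : ℕ) = F i j (x : ℕ)

end LoquaciousHighness

end

noncomputable section

open Encodable Denumerable Nat.Partrec
open scoped FirstOrder

/-! ### Oracle computability -/

section OracleComputability

variable {α β σ τ : Type*} [Primcodable α] [Primcodable β] [Primcodable σ] [Primcodable τ]
variable {O : Set (ℕ →. ℕ)}

/-! Both notions are equivalent, for the same set `D`, to `ComputesBranches D`: uniformly in `e`,
`D` computes a branch of a primitive recursive condition on finite sequences whenever there is one.
For paths this is a matter of indices and of carrying halting times along the branch.

Branches give isomorphisms because an isomorphism, its inverse and suitable moduli of convergence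
form a branch of such a condition (`exists_isomorphisms_of_computesBranches`).

Isomorphisms give branches by linear algebra over the field with two elements. Level `k` of a tree
spans a vector space whose vectors are finite sets of nodes, and "parent" induces linear maps from
each level to the one below. Take two copies of this inverse system, marking the zero vector of
level `0` in one and the set containing only the root in the other. A branch `g` yields an
isomorphism, namely adding to each vector the node of `g` at its level (`levelRel_translate`).
Conversely, any isomorphism sends the zero vectors to a coherent sequence of finite sets starting at
the root (`level_of_preserves`). By parity each node in one of these sets has a child in the next,
so a branch is found by bounded searches (`branch_of_levels`). -/

theorem ComputableIn.comp {f : β → σ} {g : α → β} (hf : ComputableIn O f)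
    (hg : ComputableIn O g) : ComputableIn O fun a => f (g a) :=
  (Nat.RecursiveIn.comp hf hg).of_eq fun n => by
    cases decode (α := α) n <;> simp [encodek]

theorem ComputableIn.pair {f : α → σ} {g : α → τ} (hf : ComputableIn O f)
    (hg : ComputableIn O g) : ComputableIn O fun a => (f a, g a) :=
  (Nat.RecursiveIn.pair hf hg).of_eq fun n => by
    cases decode (α := α) n <;> simp [Seq.seq]

theorem ComputableIn.nat_rec {f : ℕ → ℕ} {h : ℕ × ℕ × ℕ → ℕ} (hf : ComputableIn O f)
    (hh : ComputableIn O h) :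
    ComputableIn O fun p : ℕ × ℕ =>
      (Nat.rec (f p.1) (fun y i => h (p.1, y, i)) p.2 : ℕ) :=
  (Nat.RecursiveIn.prec hf hh).of_eq fun n => by
    have key : ∀ a k : ℕ,
        (Nat.rec (Part.bind (decode (α := ℕ) a) fun b => (Part.some (f b)).map encode)
          (fun y IH => IH.bind fun i =>
            Part.bind (decode (α := ℕ × ℕ × ℕ) (Nat.pair a (Nat.pair y i))) fun b =>
              (Part.some (h b)).map encode) k : Part ℕ) =
          Part.some (Nat.rec (f a) (fun y i => h (a, y, i)) k : ℕ) := by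
      intro a k
      induction k with
      | zero => simp
      | succ k ih => simp only [ih]; simp
    simpa using! key n.unpair.1 n.unpair.2

end OracleComputability

/-! ### Primitive recursive predicates -/

section PrimrecPredicates

variable {α β : Type*} [Primcodable α] [Primcodable β]

theorem PrimrecPred.imp {p q : α → Prop} (hp : PrimrecPred p) (hq : PrimrecPred q) :
    PrimrecPred fun a => p a → q a :=
  (hp.not.or hq).of_eq fun _ => imp_iff_not_or.symm

theorem PrimrecPred.forall_mem {f : α → List β} {p : α → β → Prop} (hf : Primrec f)
    (hp : PrimrecRel p) : PrimrecPred fun a => ∀ b ∈ f a, p a b :=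
  (PrimrecRel.forall_mem_list (R := fun b a => p a b) (hp.comp Primrec.snd Primrec.fst)).comp hf
    Primrec.id

theorem PrimrecPred.forall_nat_lt {f : α → ℕ} {p : α → ℕ → Prop} (hf : Primrec f)
    (hp : PrimrecRel p) : PrimrecPred fun a => ∀ b < f a, p a b :=
  (PrimrecPred.forall_mem (Primrec.list_range.comp hf) hp).of_eq (by simp)

end PrimrecPredicates

namespace LoquaciousHighness

/-! ### Indices -/

/-- Evaluation of `φ_e` at `x` for at most `n` steps. -/
def phiStage (n e x : ℕ) : Option ℕ := Code.evaln n (ofNat Code e) x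

open Classical in
/-- The value of `φ_e` at `x`, or `none` if it diverges. -/
def phiOption (e x : ℕ) : Option ℕ := (phi e x).toOption

theorem phiOption_eq_some {e x y : ℕ} : phiOption e x = some y ↔ phi e x = Part.some y := by
  classical
  rw [Part.eq_some_iff, ← Part.mem_toOption]
  rfl

/-- If `φ_e` diverges at `x`, every stage gives `none`; so the stages converge in all cases,
although the limit `phiOption` is not computable. -/
theorem eventually_phiStage (e x : ℕ) :
    ∀ᶠ n in Filter.atTop, phiStage n e x = phiOption e x := by
  rcases h : phiOption e x with _ | y
  · refine Filter.Eventually.of_forall fun n => Option.eq_none_iff_forall_not_mem.2 fun y hy => ?_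
    have : phi e x = Part.some y := Part.eq_some_iff.2 (Code.evaln_sound hy)
    rw [phiOption_eq_some.2 this] at h
    cases h
  · have := Part.eq_some_iff.1 (phiOption_eq_some.1 h)
    obtain ⟨k, hk⟩ := Code.evaln_complete.1 this
    filter_upwards [Filter.eventually_ge_atTop k] with n hn
    exact Code.evaln_mono hn hk

theorem phi_of_phiStage {n e x y : ℕ} (h : phiStage n e x = some y) : phi e x = Part.some y :=
  Part.eq_some_iff.2 (Code.evaln_sound h)

theorem exists_phiStage {e x y : ℕ} (h : phi e x = Part.some y) : ∃ n, phiStage n e x = some y :=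
  Code.evaln_complete.1 (Part.eq_some_iff.1 h)

theorem primrec_phiStage {α : Type*} [Primcodable α] {n e x : α → ℕ} (hn : Primrec n)
    (he : Primrec e) (hx : Primrec x) : Primrec fun a => phiStage (n a) (e a) (x a) :=
  Code.primrec_evaln.comp ((hn.pair ((Primrec.ofNat Code).comp he)).pair hx)

theorem exists_uniform_index {f : ℕ → ℕ → ℕ} (hf : Primrec₂ f) :
    ∃ h : ℕ → ℕ, Primrec h ∧ ∀ e x, phi (h e) x = Part.some (f e x) := by
  obtain ⟨c, hc⟩ := Code.exists_code.1 (Nat.Partrec.of_primrec (Primrec₂.unpaired'.2 hf))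
  refine ⟨fun e => encode (Code.curry c e),
    Primrec.encode.comp (Code.primrec₂_curry.comp (Primrec.const c) Primrec.id), fun e x => ?_⟩
  simp [phi, Code.eval_curry, hc]

open Classical in
theorem exists_uniform_decision {α : Type} [Primcodable α] {p : ℕ → α → Prop}
    (hp : PrimrecRel p) :
    ∃ h : ℕ → ℕ, Primrec h ∧ ∀ e a, phi (h e) (encode a) = Part.some (if p e a then 1 else 0) := by
  obtain ⟨h, hh, hphi⟩ := exists_uniform_index
    (f := fun e x => ((decode (α := α) x).map fun a => if p e a then 1 else 0).getD 0)
    (Primrec.option_getD.comp (Primrec.option_map (Primrec.decode.comp Primrec.snd)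
      (Primrec.ite (hp.comp (Primrec.fst.comp Primrec.fst) Primrec.snd)
        (Primrec.const 1) (Primrec.const 0))) (Primrec.const 0))
  exact ⟨h, hh, fun e a => by simp [hphi]⟩

theorem exists_uniform_decides {α : Type} [Primcodable α] {p : ℕ → α → Prop}
    (hp : PrimrecRel p) :
    ∃ h : ℕ → ℕ, Primrec h ∧ ∀ e, Decides (h e) {a | p e a} := by
  obtain ⟨h, hh, hphi⟩ := exists_uniform_decision hp
  exact ⟨h, hh, fun e a => ⟨fun (ha : p e a) => by rw [hphi, if_pos ha],
    fun (ha : ¬ p e a) => by rw [hphi, if_neg ha]⟩⟩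

/-! ### Uniform choice of branches -/

/-- From the parameter of a uniformly primitive recursive family of sets of finite sequences, `D`
computes, uniformly, a function all of whose initial segments lie in the corresponding set, if
there is one. -/
def ComputesBranches (D : Set ℕ) : Prop :=
  ∀ R : ℕ → List ℕ → Prop, PrimrecRel R → ∃ G : ℕ → ℕ → ℕ,
    ComputableIn {charFun D} (fun q : ℕ × ℕ => G q.1 q.2) ∧
    ∀ e, (∃ g : ℕ → ℕ, ∀ k, R e ((List.range k).map g)) → ∀ k, R e ((List.range k).map (G e))

/-- The tree of the sequences all of whose initial segments lie in the set `S`. -/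
def prefixTree (S : Set (List ℕ)) : Descriptive.tree ℕ :=
  ⟨{σ | ∀ m < σ.length + 1, σ.take m ∈ S}, by
    intro σ a h m hm
    rcases Nat.lt_or_ge m (σ.length + 1) with h' | h'
    · have := h m (by simp; omega)
      rwa [List.take_append_of_le_length (by omega)] at this
    · omega⟩

theorem take_map_range (p : ℕ → ℕ) {m k : ℕ} (h : m ≤ k) :
    ((List.range k).map p).take m = (List.range m).map p := by
  rw [← List.map_take, List.take_range, min_eq_left h]

theorem isPath_prefixTree {S : Set (List ℕ)} {p : ℕ → ℕ} :
    IsPath (prefixTree S) p ↔ ∀ k, (List.range k).map p ∈ S := by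
  constructor
  · intro h k
    have := h k k (by simp)
    rwa [take_map_range p le_rfl] at this
  · intro h k m hm
    rw [take_map_range p (by simpa [Nat.lt_succ_iff] using hm)]
    exact h m

theorem computesBranches_of_paths {D : Set ℕ} {F : ℕ → ℕ → ℕ}
    (hF : ComputableIn {charFun D} (fun q : ℕ × ℕ => F q.1 q.2))
    (h : ∀ (n : ℕ) (T : Descriptive.tree ℕ), IsTreeIndex n T → IllFounded T → IsPath T (F n)) :
    ComputesBranches D := by
  intro R hR
  obtain ⟨i, hi, hdec⟩ := exists_uniform_decides
    (p := fun e (σ : List ℕ) => ∀ m < σ.length + 1, R e (σ.take m))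
    (PrimrecPred.forall_nat_lt
      (Primrec.succ.comp (Primrec.list_length.comp Primrec.snd))
      (hR.comp (Primrec.fst.comp Primrec.fst)
        (Primrec.list_take.comp Primrec.snd (Primrec.snd.comp Primrec.fst))))
  refine ⟨fun e => F (i e), hF.comp (g := fun q : ℕ × ℕ => (i q.1, q.2))
    ((hi.computableIn.comp .fst).pair .snd), fun e ⟨g, hg⟩ => ?_⟩
  exact isPath_prefixTree.1 (h (i e) (prefixTree {σ | R e σ}) (hdec e)
    ⟨g, isPath_prefixTree.2 hg⟩)

theorem exists_paths_of_computesBranches {D : Set ℕ} (hD : ComputesBranches D) :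
    ∃ F : ℕ → ℕ → ℕ, ComputableIn {charFun D} (fun q : ℕ × ℕ => F q.1 q.2) ∧
      ∀ (n : ℕ) (T : Descriptive.tree ℕ), IsTreeIndex n T → IllFounded T → IsPath T (F n) := by
  obtain ⟨G, hG, hbr⟩ := hD
    -- Entry `m` pairs the `m`-th value of the path with a stage at which `φ_n` accepts the initial
    -- segment of length `m`. Bounding the computation makes the condition primitive recursive.
    (fun n σ => ∀ m < σ.length, phiStage (σ.getD m 0).unpair.2 n
      (encode ((σ.take m).map fun x => x.unpair.1)) = some 1)
    (PrimrecPred.forall_nat_lt (Primrec.list_length.comp Primrec.snd)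
      (Primrec.eq.comp (primrec_phiStage
        (Primrec.snd.comp (Primrec.unpair.comp
          ((Primrec.list_getD 0).comp (Primrec.snd.comp Primrec.fst) Primrec.snd)))
        (Primrec.fst.comp Primrec.fst)
        (Primrec.encode.comp (Primrec.list_map
          (Primrec.list_take.comp Primrec.snd (Primrec.snd.comp Primrec.fst))
          (Primrec.fst.comp (Primrec.unpair.comp Primrec.snd)))))
        (Primrec.const (some 1))))
  refine ⟨fun n x => (G n x).unpair.1,
    (Primrec.fst.comp Primrec.unpair).computableIn.comp hG, fun n T hT ⟨p, hp⟩ k => ?_⟩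
  choose w hw using fun k => exists_phiStage ((hT _).1 (hp k))
  -- The stage for the initial segment of length `k` sits in entry `k`, so length `k + 1` is needed
  -- to see it.
  have := hbr n ⟨fun x => Nat.pair (p x) (w x), fun k m hm => ?_⟩ (k + 1) k (by simp)
  · rw [take_map_range _ k.le_succ, List.map_map] at this
    by_contra hk
    have h0 := (hT _).2 hk
    have h1 := phi_of_phiStage this
    exact absurd (Part.some_inj.1 (h1.symm.trans h0)) one_ne_zero
  · have hm' : m < k := by simpa using hm
    rw [take_map_range _ hm'.le, List.map_map]
    simpa [hm', Function.comp_def] using hw m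

/-! ### From branches to isomorphisms -/

/-- The `c`-th condition for `u` to be an isomorphism with inverse `v` from the structure with
index `i` to the structure with index `j`, where `E e x` stands for the value of `φ_e` at `x`. -/
def IsoCondition (E : ℕ → ℕ → Option ℕ) (u v : ℕ → ℕ) (i j c : ℕ) : Prop :=
  (E i.unpair.2.unpair.1 c = some 1 →
    E j.unpair.2.unpair.1 (u c) = some 1 ∧ v (u c) = c) ∧
  (E j.unpair.2.unpair.1 c = some 1 →
    E i.unpair.2.unpair.1 (v c) = some 1 ∧ u (v c) = c) ∧
  ((∀ x ∈ ofNat (List ℕ) c.unpair.2, E i.unpair.2.unpair.1 x = some 1) →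
    (E i.unpair.1 c.unpair.1 =
        some (encode (some (Sum.inl (ofNat (List ℕ) c.unpair.2).length : ℕ ⊕ ℕ))) →
      E j.unpair.2.unpair.2 (Nat.pair c.unpair.1 (encode ((ofNat (List ℕ) c.unpair.2).map u))) =
        (E i.unpair.2.unpair.2 c).map u) ∧
    (E i.unpair.1 c.unpair.1 =
        some (encode (some (Sum.inr (ofNat (List ℕ) c.unpair.2).length : ℕ ⊕ ℕ))) →
      E j.unpair.2.unpair.2 (Nat.pair c.unpair.1 (encode ((ofNat (List ℕ) c.unpair.2).map u))) =
        E i.unpair.2.unpair.2 c))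

theorem primrecPred_isoCondition {α : Type*} [Primcodable α] {E : α → ℕ → ℕ → Option ℕ}
    {u v : α → ℕ → ℕ} {i j c : α → ℕ} (hE : Primrec fun q : α × ℕ × ℕ => E q.1 q.2.1 q.2.2)
    (hu : Primrec₂ u) (hv : Primrec₂ v) (hi : Primrec i) (hj : Primrec j) (hc : Primrec c) :
    PrimrecPred fun a => IsoCondition (E a) (u a) (v a) (i a) (j a) (c a) := by
  have hE' {f g : α → ℕ} (hf : Primrec f) (hg : Primrec g) : Primrec fun a => E a (f a) (g a) :=
    hE.comp (Primrec.id.pair (hf.pair hg))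
  have h1 {f : α → ℕ} (hf : Primrec f) : Primrec fun a => (f a).unpair.1 :=
    Primrec.fst.comp (Primrec.unpair.comp hf)
  have h2 {f : α → ℕ} (hf : Primrec f) : Primrec fun a => (f a).unpair.2 :=
    Primrec.snd.comp (Primrec.unpair.comp hf)
  have huc := hu.comp Primrec.id hc
  have hvc := hv.comp Primrec.id hc
  have hl : Primrec fun a => ofNat (List ℕ) (c a).unpair.2 := (Primrec.ofNat (List ℕ)).comp (h2 hc)
  have hlen := Primrec.list_length.comp hl
  have himg := hE' (h2 (h2 hj))
    (Primrec₂.natPair.comp (h1 hc) (Primrec.encode.comp (Primrec.list_map hl hu)))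
  have hval := hE' (h2 (h2 hi)) hc
  have hsig := hE' (h1 hi) (h1 hc)
  refine .and (.imp (Primrec.eq.comp (hE' (h1 (h2 hi)) hc) (.const _))
    (.and (Primrec.eq.comp (hE' (h1 (h2 hj)) huc) (.const _))
      (Primrec.eq.comp (hv.comp Primrec.id huc) hc)))
    (.and (.imp (Primrec.eq.comp (hE' (h1 (h2 hj)) hc) (.const _))
      (.and (Primrec.eq.comp (hE' (h1 (h2 hi)) hvc) (.const _))
        (Primrec.eq.comp (hu.comp Primrec.id hvc) hc)))
    (.imp (.forall_mem hl (Primrec.eq.comp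
        (hE.comp (Primrec.fst.pair (((h1 (h2 hi)).comp Primrec.fst).pair Primrec.snd)))
        (.const _)))
      (.and (.imp (Primrec.eq.comp hsig ?_) (Primrec.eq.comp himg (Primrec.option_map hval hu)))
        (.imp (Primrec.eq.comp hsig ?_) (Primrec.eq.comp himg hval)))))
  · exact Primrec.option_some.comp
      (Primrec.encode.comp (Primrec.option_some.comp (Primrec.sumInl.comp hlen)))
  · exact Primrec.option_some.comp
      (Primrec.encode.comp (Primrec.option_some.comp (Primrec.sumInr.comp hlen)))

/-- For fixed `c` the condition consults only finitely many values of `E`, `u` and `v`, and each of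
them stabilizes. -/
theorem eventually_isoCondition_iff {E : ℕ → ℕ → ℕ → Option ℕ} {E' : ℕ → ℕ → Option ℕ}
    {u v : ℕ → ℕ → ℕ} {u' v' : ℕ → ℕ} (hE : ∀ e x, ∀ᶠ n in Filter.atTop, E n e x = E' e x)
    (hu : ∀ x, ∀ᶠ n in Filter.atTop, u n x = u' x) (hv : ∀ x, ∀ᶠ n in Filter.atTop, v n x = v' x)
    (i j c : ℕ) :
    ∀ᶠ n in Filter.atTop,
      (IsoCondition (E n) (u n) (v n) i j c ↔ IsoCondition E' u' v' i j c) := by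
  have hl : ∀ᶠ n in Filter.atTop, ∀ x ∈ {x | x ∈ ofNat (List ℕ) c.unpair.2},
      E n i.unpair.2.unpair.1 x = E' i.unpair.2.unpair.1 x ∧ u n x = u' x :=
    (Filter.eventually_all_finite (List.finite_toSet _)).2 fun x _ => (hE _ x).and (hu x)
  have hmap : ∀ᶠ n in Filter.atTop, (E' i.unpair.2.unpair.2 c).map (u n) =
      (E' i.unpair.2.unpair.2 c).map u' := by
    rcases E' i.unpair.2.unpair.2 c with _ | y
    · simp
    · filter_upwards [hu y] with n hn
      simp [hn]
  filter_upwards [hE i.unpair.2.unpair.1 c, hE j.unpair.2.unpair.1 c,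
    hE j.unpair.2.unpair.1 (u' c), hE i.unpair.2.unpair.1 (v' c), hu c, hv c, hv (u' c), hu (v' c),
    hl, hE i.unpair.1 c.unpair.1, hE i.unpair.2.unpair.2 c, hmap,
    hE j.unpair.2.unpair.2
      (Nat.pair c.unpair.1 (encode ((ofNat (List ℕ) c.unpair.2).map u')))]
    with n e1 e2 e3 e4 e5 e6 e7 e8 e9 e10 e11 e12 e13
  have e14 : (ofNat (List ℕ) c.unpair.2).map (u n) = (ofNat (List ℕ) c.unpair.2).map u' :=
    List.map_congr_left fun x hx => (e9 x hx).2
  have e15 : (∀ x ∈ ofNat (List ℕ) c.unpair.2, E n i.unpair.2.unpair.1 x = some 1) ↔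
      ∀ x ∈ ofNat (List ℕ) c.unpair.2, E' i.unpair.2.unpair.1 x = some 1 :=
    forall₂_congr fun x hx => by rw [(e9 x hx).1]
  rw [IsoCondition, IsoCondition, e15, e1, e2, e5, e6, e3, e4, e7, e8, e10, e11, e12, e14, e13]

theorem Decides.phiOption_eq_some_one {b : ℕ} {A : Set ℕ} (h : Decides b A) (x : ℕ) :
    phiOption b x = some 1 ↔ x ∈ A := by
  rw [phiOption_eq_some]
  refine ⟨fun hx => ?_, (h x).1⟩
  by_contra hA
  exact absurd (Part.some_inj.1 (hx.symm.trans ((h x).2 hA))) one_ne_zero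

open FirstOrder.Language.Structure in
open Classical in
theorem phiOption_rel {s : Signature} {A : Set ℕ} [s.lang.Structure A] {c : ℕ}
    (h : ∀ (m : ℕ) (r : s.lang.Relations m) (x : Fin m → A),
      (RelMap r x → phi c (encode (r.1, List.ofFn fun t => (x t : ℕ))) = Part.some 1) ∧
      (¬ RelMap r x → phi c (encode (r.1, List.ofFn fun t => (x t : ℕ))) = Part.some 0))
    {m : ℕ} (r : s.lang.Relations m) (x : Fin m → A) :
    phiOption c (Nat.pair r.1 (encode (List.ofFn fun t => (x t : ℕ)))) =
      some (if RelMap r x then 1 else 0) := by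
  rw [phiOption_eq_some]
  split_ifs with hr
  · exact (h m r x).1 hr
  · exact (h m r x).2 hr

section

variable {i j : ℕ} {s : Signature} {A B : Set ℕ} [s.lang.Structure A] [s.lang.Structure B]

open FirstOrder.Language.Structure

/-- The number `c` plays three roles: an element of `A`, an element of `B`, and the code of a symbol
with a tuple of arguments. Carrying the inverse `v` turns surjectivity into a condition without
existential quantifier. -/
theorem exists_equiv_of_isoCondition (hi : IsStructureIndex i s A) (hj : IsStructureIndex j s B)
    {u v : ℕ → ℕ} (h : ∀ c, IsoCondition phiOption u v i j c) :
    ∃ g : A ≃[s.lang] B, ∀ x : A, (g x : ℕ) = u x := by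
  classical
  obtain ⟨a, b, c, rfl, hsig, hdom, hfun, hrel⟩ := hi
  obtain ⟨a', b', c', rfl, hsig', hdom', hfun', hrel'⟩ := hj
  simp only [IsoCondition, Nat.unpair_pair, hdom.phiOption_eq_some_one,
    hdom'.phiOption_eq_some_one] at h
  have hsymb (m : ℕ) (k : ℕ) (x : Fin m → A) :=
    (h (Nat.pair k (encode (List.ofFn fun t => (x t : ℕ))))).2.2
      (by simp [List.mem_ofFn])
  have hs (k : ℕ) : phiOption a k = some (encode (s k)) := phiOption_eq_some.2 (hsig k)
  simp only [Nat.unpair_pair, ofNat_encode, List.length_ofFn, List.map_ofFn, hs] at hsymb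
  let e : A ≃ B :=
    { toFun x := ⟨u x, ((h x).1 x.2).1⟩
      invFun y := ⟨v y, ((h y).2.1 y.2).1⟩
      left_inv x := Subtype.ext ((h x).1 x.2).2
      right_inv y := Subtype.ext ((h y).2.1 y.2).2 }
  refine ⟨⟨e, fun {m} f x => ?_, fun {m} r x => ?_⟩, fun x => rfl⟩
  · have := (hsymb m f.1 x).1 (by rw [f.2])
    have h1 : phiOption c (Nat.pair f.1 (encode (List.ofFn fun t => (x t : ℕ)))) =
      some (funMap f x : A).1 := phiOption_eq_some.2 (hfun m f x)
    have h2 : phiOption c' (Nat.pair f.1 (encode (List.ofFn (u ∘ fun t => (x t : ℕ))))) =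
      some (funMap f (e ∘ x) : B).1 := phiOption_eq_some.2 (hfun' m f (e ∘ x))
    rw [h1, h2] at this
    exact Subtype.ext (Option.some.inj this).symm
  · have := (hsymb m r.1 x).2 (by rw [r.2])
    have h2 : phiOption c' (Nat.pair r.1 (encode (List.ofFn (u ∘ fun t => (x t : ℕ))))) =
      some (if RelMap r (e ∘ x) then 1 else 0) := phiOption_rel hrel' r (e ∘ x)
    rw [phiOption_rel hrel r x, h2] at this
    change RelMap r (e ∘ x) ↔ RelMap r x
    have := Option.some.inj this
    split_ifs at this with p1 p2 p2
    · exact iff_of_true p1 p2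
    · exact iff_of_false p1 p2

theorem exists_isoCondition (hi : IsStructureIndex i s A) (hj : IsStructureIndex j s B)
    (g : A ≃[s.lang] B) : ∃ u v : ℕ → ℕ, ∀ c, IsoCondition phiOption u v i j c := by
  classical
  obtain ⟨a, b, c, rfl, hsig, hdom, hfun, hrel⟩ := hi
  obtain ⟨a', b', c', rfl, hsig', hdom', hfun', hrel'⟩ := hj
  have hs (k : ℕ) : phiOption a k = some (encode (s k)) := phiOption_eq_some.2 (hsig k)
  -- The value off the universe is immaterial: the conditions are guarded by membership.
  let u : ℕ → ℕ := fun x => if hx : x ∈ A then g ⟨x, hx⟩ else 0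
  let v : ℕ → ℕ := fun y => if hy : y ∈ B then g.symm ⟨y, hy⟩ else 0
  have hu (x : A) : u x = g x := dif_pos x.2
  have hv (y : B) : v y = g.symm y := dif_pos y.2
  refine ⟨u, v, fun d => ?_⟩
  simp only [IsoCondition, Nat.unpair_pair, hdom.phiOption_eq_some_one,
    hdom'.phiOption_eq_some_one, hs]
  refine ⟨fun hd => ?_, fun hd => ?_, fun hl => ?_⟩
  · rw [hu ⟨d, hd⟩, hv]
    simp
  · rw [hv ⟨d, hd⟩, hu]
    simp
  · obtain ⟨⟨k, l⟩, rfl⟩ : ∃ q : ℕ × List ℕ, encode q = d := ⟨ofNat _ d, encode_ofNat d⟩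
    simp only [encode_prod_val, encode_nat, Nat.unpair_pair, ofNat_encode] at hl ⊢
    obtain ⟨x, hx⟩ : ∃ x : Fin l.length → A, l = List.ofFn fun t => (x t : ℕ) :=
      ⟨fun t => ⟨l[t], hl _ (List.getElem_mem _)⟩, by simp⟩
    have hm : l.map u = List.ofFn fun t => (g (x t) : ℕ) := by
      conv_lhs => rw [hx]
      rw [List.map_ofFn]
      exact congrArg List.ofFn (funext fun t => hu (x t))
    rw [hm]
    generalize hlen : l.length = m at x hx
    subst hx
    refine ⟨fun h => ?_, fun h => ?_⟩
    · have hk := encode_injective (Option.some.inj h)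
      have h1 := phiOption_eq_some.2 (hfun m ⟨k, hk⟩ x)
      have h2 := phiOption_eq_some.2 (hfun' m ⟨k, hk⟩ (g ∘ x))
      rw [encode_prod_val] at h1 h2
      refine h2.trans (Eq.trans ?_ (congrArg (Option.map u) h1).symm)
      rw [Option.map_some, hu]
      exact congrArg (fun y : B => some (y : ℕ)) (g.map_fun (n := m) ⟨k, hk⟩ x).symm
    · have hk := encode_injective (Option.some.inj h)
      have h1 := phiOption_rel hrel (m := m) ⟨k, hk⟩ x
      have h2 := phiOption_rel hrel' (m := m) ⟨k, hk⟩ (g ∘ x)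
      refine h2.trans (Eq.trans ?_ h1.symm)
      congr 2
      exact propext (g.map_rel ⟨k, hk⟩ x)

end

/-- A branch carries, at `c`, the values `u c`, `v c` and a number `w c`. The `c`-th condition is
tested with stagewise approximations, at every length beyond both `c` and `w c`. It may fail at
early stages even for a true isomorphism, so `w c` delays the test until the approximations have
settled. -/
theorem exists_isomorphisms_of_computesBranches {D : Set ℕ} (hD : ComputesBranches D) :
    ∃ F : ℕ → ℕ → ℕ → ℕ, ComputableIn {charFun D} (fun q : ℕ × ℕ × ℕ => F q.1 q.2.1 q.2.2) ∧
      ∀ (i j : ℕ) (s : Signature) (A B : Set ℕ) [s.lang.Structure A] [s.lang.Structure B],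
        IsStructureIndex i s A → IsStructureIndex j s B → Nonempty (A ≃[s.lang] B) →
          ∃ g : A ≃[s.lang] B, ∀ x : A, (g x : ℕ) = F i j (x : ℕ) := by
  have hlook : Primrec fun q : ((ℕ × List ℕ) × ℕ) × ℕ => (q.1.1.2.getD q.2 0).unpair.1.unpair :=
    Primrec.unpair.comp (Primrec.fst.comp (Primrec.unpair.comp ((Primrec.list_getD 0).comp
      (Primrec.snd.comp (Primrec.fst.comp Primrec.fst)) Primrec.snd)))
  have hpair : Primrec fun q : (ℕ × List ℕ) × ℕ => q.1.1.unpair :=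
    Primrec.unpair.comp (Primrec.fst.comp Primrec.fst)
  have hlen : Primrec fun q : (ℕ × List ℕ) × ℕ => q.1.2.length :=
    Primrec.list_length.comp (Primrec.snd.comp Primrec.fst)
  obtain ⟨G, hG, hbr⟩ := hD
    (fun e σ => ∀ c < σ.length, (σ.getD c 0).unpair.2 ≤ σ.length →
      IsoCondition (phiStage σ.length) (fun x => (σ.getD x 0).unpair.1.unpair.1)
        (fun x => (σ.getD x 0).unpair.1.unpair.2) e.unpair.1 e.unpair.2 c)
    (PrimrecPred.forall_nat_lt (Primrec.list_length.comp Primrec.snd)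
      (.imp (Primrec.nat_le.comp (Primrec.snd.comp (Primrec.unpair.comp
          ((Primrec.list_getD 0).comp (Primrec.snd.comp Primrec.fst) Primrec.snd))) hlen)
        (primrecPred_isoCondition
          (primrec_phiStage (hlen.comp Primrec.fst) (Primrec.fst.comp Primrec.snd)
            (Primrec.snd.comp Primrec.snd))
          (Primrec.fst.comp hlook) (Primrec.snd.comp hlook)
          (Primrec.fst.comp hpair) (Primrec.snd.comp hpair) Primrec.snd)))
  have hget (p : ℕ → ℕ) (x : ℕ) :
      ∀ᶠ n in Filter.atTop, ((List.range n).map p).getD x 0 = p x := by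
    filter_upwards [Filter.eventually_gt_atTop x] with n hn
    simp [hn]
  have hev (p : ℕ → ℕ) (i j c : ℕ) := eventually_isoCondition_iff eventually_phiStage
    (fun x => (hget p x).mono fun n hn => congrArg (fun y : ℕ => y.unpair.1.unpair.1) hn)
    (fun x => (hget p x).mono fun n hn => congrArg (fun y : ℕ => y.unpair.1.unpair.2) hn) i j c
  refine ⟨fun i j x => (G (Nat.pair i j) x).unpair.1.unpair.1, ?_,
    fun i j s A B _ _ hi hj ⟨g⟩ => ?_⟩
  · exact (Primrec.fst.comp (Primrec.unpair.comp
      (Primrec.fst.comp Primrec.unpair))).computableIn.comp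
        (hG.comp (g := fun q : ℕ × ℕ × ℕ => (Nat.pair q.1 q.2.1, q.2.2))
          ((Primrec₂.natPair.comp Primrec.fst (Primrec.fst.comp Primrec.snd)).pair
            (Primrec.snd.comp Primrec.snd)).computableIn)
  · obtain ⟨u, v, huv⟩ := exists_isoCondition hi hj g
    have key := hbr (Nat.pair i j) ?_
    · refine exists_equiv_of_isoCondition hi hj
        (u := fun x => (G (Nat.pair i j) x).unpair.1.unpair.1)
        (v := fun x => (G (Nat.pair i j) x).unpair.1.unpair.2) fun c => ?_
      -- At one sufficiently late length the condition is both tested and equivalent to its limit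
      -- form.
      obtain ⟨n, h1, h2, h3⟩ := ((hev (G (Nat.pair i j)) i j c).and
        ((Filter.eventually_gt_atTop c).and
          (Filter.eventually_ge_atTop (G (Nat.pair i j) c).unpair.2))).exists
      refine h1.1 ?_
      simpa [h2, h3] using key n c (by simpa using h2)
    -- The cut-off functions are what `getD` with default `0` reads from an initial segment of
    -- length `n`, so their modulus `w` depends only on `u` and `v` and can be put into the branch.
    · choose w hw using fun c => Filter.eventually_atTop.1
        (eventually_isoCondition_iff eventually_phiStage
          (u := fun n x => if x < n then u x else 0) (u' := u)
          (v := fun n x => if x < n then v x else 0) (v' := v)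
          (fun x => (Filter.eventually_gt_atTop x).mono fun n hn => if_pos hn)
          (fun x => (Filter.eventually_gt_atTop x).mono fun n hn => if_pos hn) i j c)
      refine ⟨fun x => Nat.pair (Nat.pair (u x) (v x)) (w x), fun n c hc hwc => ?_⟩
      have hc' : c < n := by simpa using hc
      have := (hw c n (by simpa [hc'] using hwc)).2 (huv c)
      convert this using 1
      · simp
      · funext x
        by_cases hx : x < n <;> simp [hx]
      · funext x
        by_cases hx : x < n <;> simp [hx]
      · simp
      · simp

/-! ### Finite sets of nodes, coded by binary expansions -/

/-- The parity of the number of `i < N` in the finite set coded by `x` that satisfy `f`. -/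
def parityBelow (f : ℕ → Bool) (x : ℕ) : ℕ → Bool
  | 0 => false
  | N + 1 => xor (parityBelow f x N) (x.testBit N && f N)

/-- The parity of the number of elements of the finite set coded by `x` that satisfy `f`. -/
def parity (f : ℕ → Bool) (x : ℕ) : Bool := parityBelow f x x

theorem testBit_eq_false_of_le {x i : ℕ} (h : x ≤ i) : x.testBit i = false :=
  Nat.testBit_lt_two_pow (h.trans_lt Nat.lt_two_pow_self)

theorem lt_of_testBit {x i : ℕ} (h : x.testBit i = true) : i < x := by
  by_contra hx
  rw [testBit_eq_false_of_le (not_lt.1 hx)] at h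
  cases h

theorem parityBelow_eq_parity (f : ℕ → Bool) {x N : ℕ} (h : x ≤ N) :
    parityBelow f x N = parity f x := by
  induction N, h using Nat.le_induction with
  | base => rfl
  | succ N hN ih => simp [parityBelow, ih, testBit_eq_false_of_le hN]

/-- Additivity modulo `2`: bitwise xor is symmetric difference, the addition of the vector space. -/
theorem parityBelow_xor (f : ℕ → Bool) (x y N : ℕ) :
    parityBelow f (x ^^^ y) N = xor (parityBelow f x N) (parityBelow f y N) := by
  induction N with
  | zero => rfl
  | succ N ih =>
    simp only [parityBelow, ih, Nat.testBit_xor]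
    cases parityBelow f x N <;> cases parityBelow f y N <;> cases x.testBit N <;>
      cases y.testBit N <;> cases f N <;> rfl

theorem parity_xor (f : ℕ → Bool) (x y : ℕ) :
    parity f (x ^^^ y) = xor (parity f x) (parity f y) := by
  have h := parityBelow_xor f x y (max (x ^^^ y) (max x y))
  rwa [parityBelow_eq_parity f (le_max_left _ _),
    parityBelow_eq_parity f ((le_max_left _ _).trans (le_max_right _ _)),
    parityBelow_eq_parity f ((le_max_right _ _).trans (le_max_right _ _))] at h

theorem parityBelow_two_pow (f : ℕ → Bool) (c N : ℕ) :
    parityBelow f (2 ^ c) N = (decide (c < N) && f c) := by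
  induction N with
  | zero => simp [parityBelow]
  | succ N ih =>
    rw [parityBelow, ih, Nat.testBit_two_pow]
    rcases lt_trichotomy c N with h | rfl | h
    · simp [h, h.ne, Nat.lt_succ_of_lt h]
    · simp
    · simp [h.ne', not_lt.2 h.le, not_lt.2 (Nat.succ_le_of_lt h)]

theorem parity_two_pow (f : ℕ → Bool) (c : ℕ) : parity f (2 ^ c) = f c := by
  rw [parity, parityBelow_two_pow, decide_eq_true Nat.lt_two_pow_self, Bool.true_and]

theorem exists_of_parityBelow {f : ℕ → Bool} {x N : ℕ} (h : parityBelow f x N = true) :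
    ∃ i, x.testBit i = true ∧ f i = true := by
  induction N with
  | zero => cases h
  | succ N ih =>
    by_cases hN : parityBelow f x N = true
    · exact ih hN
    · rw [parityBelow, Bool.eq_false_iff.2 hN, Bool.false_xor, Bool.and_eq_true] at h
      exact ⟨N, h⟩

theorem primrec_testBit : Primrec₂ Nat.testBit := by
  have hpow : Primrec₂ ((· ^ ·) : ℕ → ℕ → ℕ) := Primrec₂.unpaired'.1 Nat.Primrec.pow
  refine ((Primrec.eq.comp (Primrec.nat_mod.comp (Primrec.nat_div.comp Primrec.fst
    (hpow.comp (Primrec.const 2) Primrec.snd)) (Primrec.const 2)) (Primrec.const 1)).decide).of_eq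
    fun q => ?_
  rw [Nat.testBit_eq_decide_div_mod_eq]

theorem primrec_parity {α : Type*} [Primcodable α] {f : α → ℕ → Bool} {x : α → ℕ}
    (hf : Primrec₂ f) (hx : Primrec x) : Primrec fun a => parity (f a) (x a) := by
  refine (Primrec.nat_rec' (h := fun a (q : ℕ × Bool) =>
    xor q.2 ((x a).testBit q.1 && f a q.1)) hx (Primrec.const false) ?_).of_eq fun a => ?_
  · have h1 : Primrec fun q : α × ℕ × Bool => q.2.1 := Primrec.fst.comp Primrec.snd
    exact (Primrec.dom_bool₂ xor).comp (Primrec.snd.comp Primrec.snd)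
      (Primrec.and.comp (primrec_testBit.comp (hx.comp Primrec.fst) h1)
        (hf.comp Primrec.fst h1))
  · have (N : ℕ) : (Nat.rec false (fun n b => xor b ((x a).testBit n && f a n)) N : Bool) =
        parityBelow (f a) (x a) N := by
      induction N with
      | zero => rfl
      | succ N ih => simp only [parityBelow, ← ih]
    exact this (x a)

/-- The code of the tail of the list with code `i`. -/
def tailCode (i : ℕ) : ℕ := encode (ofNat (List ℕ) i).tail

theorem primrec_tailCode : Primrec tailCode :=
  Primrec.encode.comp (Primrec.list_tail.comp (Primrec.ofNat (List ℕ)))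

theorem tailCode_le (i : ℕ) : tailCode i ≤ i := by
  obtain ⟨l, rfl⟩ : ∃ l : List ℕ, encode l = i := ⟨ofNat _ i, encode_ofNat i⟩
  rw [tailCode, ofNat_encode]
  cases l with
  | nil => exact le_rfl
  | cons a l =>
    rw [List.tail_cons, encode_list_cons]
    exact (Nat.right_le_pair _ _).trans (Nat.le_succ _)

/-- The finite set coded by `y` is the image modulo `2` under `tailCode` of the one coded
by `x`. -/
def IsTailImage (x y : ℕ) : Prop :=
  ∀ j, y.testBit j = parity (fun i => decide (tailCode i = j)) x

/-- Elements of a coded set are smaller than its code, and tails do not increase codes; hence both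
sides vanish beyond the bound. This makes the relation primitive recursive. -/
theorem isTailImage_iff_forall_lt {x y : ℕ} :
    IsTailImage x y ↔ ∀ j < x + y, y.testBit j = parity (fun i => decide (tailCode i = j)) x := by
  refine ⟨fun h j _ => h j, fun h j => ?_⟩
  rcases lt_or_ge j (x + y) with hj | hj
  · exact h j hj
  · rw [testBit_eq_false_of_le (le_of_add_le_right hj), eq_comm, ← Bool.not_eq_true]
    intro hp
    obtain ⟨i, hi, hij⟩ := exists_of_parityBelow hp
    have := lt_of_testBit hi
    have := tailCode_le i
    have := of_decide_eq_true hij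
    omega

theorem primrecRel_isTailImage : PrimrecRel IsTailImage := by
  refine PrimrecPred.of_eq (PrimrecPred.forall_nat_lt
    (p := fun (q : ℕ × ℕ) j => q.2.testBit j = parity (fun i => decide (tailCode i = j)) q.1)
    (Primrec.nat_add.comp Primrec.fst Primrec.snd)
    (Primrec.eq.comp (primrec_testBit.comp (Primrec.snd.comp Primrec.fst) Primrec.snd)
      (primrec_parity ?_ (Primrec.fst.comp Primrec.fst)))) fun q => isTailImage_iff_forall_lt.symm
  exact (Primrec.eq.comp (primrec_tailCode.comp Primrec.snd)
    (Primrec.snd.comp Primrec.fst)).decide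

theorem isTailImage_zero : IsTailImage 0 0 := fun j => by simp [parity, parityBelow]

/-- Adding a node above and its parent below changes both sides of the defining equation by the same
bit, that of `j = c`. -/
theorem isTailImage_xor_two_pow {x y c c' : ℕ} (hc : tailCode c' = c) :
    IsTailImage (x ^^^ 2 ^ c') (y ^^^ 2 ^ c) ↔ IsTailImage x y := by
  refine forall_congr' fun j => ?_
  rw [parity_xor, parity_two_pow, Nat.testBit_xor, Nat.testBit_two_pow, hc]
  exact Bool.xor_left_inj

/-! ### Structures with one binary relation -/

/-- The signature all of whose symbols are binary relation symbols. -/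
def binarySignature : Signature := fun _ => some (Sum.inr 2)

/-- The structure on `A` in which every symbol denotes the relation `Q`. -/
@[reducible]
def binaryStructure (A : Set ℕ) (Q : ℕ → ℕ → Prop) : binarySignature.lang.Structure A where
  funMap f := absurd f.2 (by simp [binarySignature])
  RelMap _ x :=
    Q ((List.ofFn fun t => (x t : ℕ)).getD 0 0) ((List.ofFn fun t => (x t : ℕ)).getD 1 0)

theorem exists_binaryStructure_index {U : ℕ → ℕ → Prop} {Q : ℕ → ℕ → ℕ → Prop}
    (hU : PrimrecRel U) (hQ : PrimrecPred fun q : ℕ × ℕ × ℕ => Q q.1 q.2.1 q.2.2) :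
    ∃ h : ℕ → ℕ → ℕ, Primrec₂ h ∧ ∀ e m,
      @IsStructureIndex (h e m) binarySignature {z | U e z} (binaryStructure _ (Q m)) := by
  obtain ⟨a, -, ha⟩ := exists_uniform_index
    (f := fun _ _ => encode (some (Sum.inr 2 : ℕ ⊕ ℕ))) (Primrec.const _)
  obtain ⟨b, hb, hdec⟩ := exists_uniform_decides hU
  obtain ⟨c, hc, hrel⟩ := exists_uniform_decision
    (p := fun m (q : ℕ × List ℕ) => Q m (q.2.getD 0 0) (q.2.getD 1 0))
    (hQ.comp (f := fun r : ℕ × ℕ × List ℕ => (r.1, r.2.2.getD 0 0, r.2.2.getD 1 0))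
      (Primrec.fst.pair
        (((Primrec.list_getD 0).comp (Primrec.snd.comp Primrec.snd) (Primrec.const 0)).pair
          ((Primrec.list_getD 0).comp (Primrec.snd.comp Primrec.snd) (Primrec.const 1)))))
  refine ⟨fun e m => Nat.pair (a 0) (Nat.pair (b e) (c m)),
    Primrec₂.natPair.comp (Primrec.const _)
      (Primrec₂.natPair.comp (hb.comp Primrec.fst) (hc.comp Primrec.snd)),
    fun e m => ⟨a 0, b e, c m, rfl, fun k => ha 0 k, hdec e, fun n f => ?_, fun n r x => ?_⟩⟩
  · exact absurd f.2 (by simp [binarySignature])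
  · rw [hrel]
    exact ⟨fun h => congrArg Part.some (if_pos h), fun h => congrArg Part.some (if_neg h)⟩

/-- A bijection respecting the binary relations is an isomorphism. -/
def equivBinaryStructure {A B : Set ℕ} {Q Q' : ℕ → ℕ → Prop} (e : A ≃ B)
    (he : ∀ x y : A, Q' (e x) (e y) ↔ Q x y) :
    @FirstOrder.Language.Equiv binarySignature.lang A B (binaryStructure A Q)
      (binaryStructure B Q') :=
  letI := binaryStructure A Q
  letI := binaryStructure B Q'
  { e with
    map_fun' := fun f => absurd f.2 (by simp [binarySignature])
    map_rel' := fun {n} r x => by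
      obtain rfl : 2 = n := Sum.inr_injective (Option.some_injective _ r.2)
      exact he (x 0) (x 1) }

/-- The bijection underlying an isomorphism of structures with one binary relation. -/
def binaryStructureBijection {A B : Set ℕ} {Q Q' : ℕ → ℕ → Prop}
    (g : @FirstOrder.Language.Equiv binarySignature.lang A B (binaryStructure A Q)
      (binaryStructure B Q')) : A ≃ B :=
  letI := binaryStructure A Q
  letI := binaryStructure B Q'
  g.toEquiv

theorem rel_binaryStructureBijection_iff {A B : Set ℕ} {Q Q' : ℕ → ℕ → Prop}
    (g : @FirstOrder.Language.Equiv binarySignature.lang A B (binaryStructure A Q)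
      (binaryStructure B Q')) (x y : A) :
    Q' (binaryStructureBijection g x) (binaryStructureBijection g y) ↔ Q x y :=
  letI := binaryStructure A Q
  letI := binaryStructure B Q'
  g.map_rel' (n := 2) ⟨0, rfl⟩ ![x, y]

/-! ### From isomorphisms to branches -/

/-- The pairs `(k, x)` such that `x` codes a finite set of codes of sequences of length `k` which
lie, in reverse order, in `S`. -/
def nodeSets (S : List ℕ → Prop) : Set ℕ :=
  {z | ∀ i < z.unpair.2, z.unpair.2.testBit i = true →
    (ofNat (List ℕ) i).length = z.unpair.1 ∧ S (ofNat (List ℕ) i).reverse}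

/-- The relation between a finite set of nodes and its image one level below, with a loop
at `m`. -/
def LevelRel (m z w : ℕ) : Prop :=
  (z.unpair.1 = w.unpair.1 + 1 ∧ IsTailImage z.unpair.2 w.unpair.2) ∨ (z = m ∧ w = m)

/-- No vector lies one level above itself, so the only loop is the one at `m`: it singles out the
marked vector without a second symbol. -/
theorem levelRel_self {m z : ℕ} : LevelRel m z z ↔ z = m := by
  simp [LevelRel]

theorem primrecPred_levelRel : PrimrecPred fun q : ℕ × ℕ × ℕ => LevelRel q.1 q.2.1 q.2.2 := by
  have h1 : Primrec fun q : ℕ × ℕ × ℕ => q.2.1 := Primrec.fst.comp Primrec.snd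
  have h2 : Primrec fun q : ℕ × ℕ × ℕ => q.2.2 := Primrec.snd.comp Primrec.snd
  have u1 := Primrec.unpair.comp h1
  have u2 := Primrec.unpair.comp h2
  exact .or (.and (Primrec.eq.comp (Primrec.fst.comp u1)
      (Primrec.succ.comp (Primrec.fst.comp u2)))
      (primrecRel_isTailImage.comp (Primrec.snd.comp u1) (Primrec.snd.comp u2)))
    (.and (Primrec.eq.comp h1 Primrec.fst) (Primrec.eq.comp h2 Primrec.fst))

theorem primrecRel_nodeSets {R : ℕ → List ℕ → Prop} (hR : PrimrecRel R) :
    PrimrecRel fun e z => z ∈ nodeSets (R e) := by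
  have hz : Primrec fun q : (ℕ × ℕ) × ℕ => q.1.2.unpair :=
    Primrec.unpair.comp (Primrec.snd.comp Primrec.fst)
  have hl : Primrec fun q : (ℕ × ℕ) × ℕ => ofNat (List ℕ) q.2 :=
    (Primrec.ofNat (List ℕ)).comp Primrec.snd
  exact PrimrecPred.forall_nat_lt (Primrec.snd.comp (Primrec.unpair.comp Primrec.snd))
    (.imp (Primrec.eq.comp (primrec_testBit.comp (Primrec.snd.comp hz) Primrec.snd)
        (Primrec.const true))
      (.and (Primrec.eq.comp (Primrec.list_length.comp hl) (Primrec.fst.comp hz))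
        (hR.comp (Primrec.fst.comp Primrec.fst)
          (Primrec.list_reverse.comp hl))))

/-- The code of the reversal of the initial segment of `g` of length `k`. -/
def segmentCode (g : ℕ → ℕ) (k : ℕ) : ℕ := encode ((List.range k).map g).reverse

theorem tailCode_segmentCode (g : ℕ → ℕ) (k : ℕ) :
    tailCode (segmentCode g (k + 1)) = segmentCode g k := by
  simp [tailCode, segmentCode, List.range_succ]

/-- Translation by the initial segments of `g`. -/
def translate (g : ℕ → ℕ) (z : ℕ) : ℕ :=
  Nat.pair z.unpair.1 (z.unpair.2 ^^^ 2 ^ segmentCode g z.unpair.1)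

theorem translate_translate (g : ℕ → ℕ) (z : ℕ) : translate g (translate g z) = z := by
  simp [translate]

theorem translate_mem {S : List ℕ → Prop} {g : ℕ → ℕ} (hg : ∀ k, S ((List.range k).map g)) {z : ℕ}
    (hz : z ∈ nodeSets S) : translate g z ∈ nodeSets S := by
  intro i _ hbit
  simp only [translate, Nat.unpair_pair, Nat.testBit_xor] at hbit ⊢
  by_cases hi : z.unpair.2.testBit i = true
  · exact hz i (lt_of_testBit hi) hi
  · rw [Bool.eq_false_iff.2 hi, Bool.false_xor, Nat.testBit_two_pow, decide_eq_true_iff] at hbit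
    subst hbit
    simpa [segmentCode] using hg z.unpair.1

/-- The empty sequence has code `0`, so the set containing only the root is coded by `2 ^ 0 = 1`. -/
theorem translate_mark (g : ℕ → ℕ) : translate g (Nat.pair 0 0) = Nat.pair 0 1 := by
  simp [translate, segmentCode]

theorem levelRel_translate (g : ℕ → ℕ) (z w : ℕ) :
    LevelRel (Nat.pair 0 1) (translate g z) (translate g w) ↔ LevelRel (Nat.pair 0 0) z w := by
  have hinj (x : ℕ) : translate g x = Nat.pair 0 1 ↔ x = Nat.pair 0 0 := by
    rw [← translate_mark g, (Function.LeftInverse.injective (translate_translate g)).eq_iff]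
  rw [LevelRel, LevelRel, hinj, hinj]
  refine or_congr_left ?_
  simp only [translate, Nat.unpair_pair]
  refine and_congr_right fun h => ?_
  rw [h]
  exact isTailImage_xor_two_pow (tailCode_segmentCode g _)

/-- The translation by the initial segments of `g`, as a bijection of `nodeSets S`. -/
def translateEquiv {S : List ℕ → Prop} {g : ℕ → ℕ} (hg : ∀ k, S ((List.range k).map g)) :
    nodeSets S ≃ nodeSets S where
  toFun z := ⟨translate g z, translate_mem hg z.2⟩
  invFun z := ⟨translate g z, translate_mem hg z.2⟩
  left_inv z := Subtype.ext (translate_translate g z)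
  right_inv z := Subtype.ext (translate_translate g z)

theorem empty_mem_nodeSets (S : List ℕ → Prop) (k : ℕ) : Nat.pair k 0 ∈ nodeSets S := by
  simp [nodeSets]

/-- The loop fixes the image of the zero vector of level `0`, and the edges between successive zero
vectors then determine the level of each further image. Linearity of `f` is not needed. -/
theorem level_of_preserves {S : List ℕ → Prop} (f : nodeSets S ≃ nodeSets S)
    (hf : ∀ x y, LevelRel (Nat.pair 0 1) (f x) (f y) ↔ LevelRel (Nat.pair 0 0) x y)
    {t : ℕ → ℕ} (ht : ∀ k, (f ⟨Nat.pair k 0, empty_mem_nodeSets S k⟩ : ℕ).unpair.2 = t k) :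
    t 0 = 1 ∧ (∀ k, IsTailImage (t (k + 1)) (t k)) ∧
      ∀ k i, (t k).testBit i = true →
        (ofNat (List ℕ) i).length = k ∧ S (ofNat (List ℕ) i).reverse := by
  set z : ℕ → nodeSets S := fun k => f ⟨Nat.pair k 0, empty_mem_nodeSets S k⟩ with hz
  have h0 : (z 0 : ℕ) = Nat.pair 0 1 := levelRel_self.1 ((hf _ _).2 (levelRel_self.2 rfl))
  have hsucc (k : ℕ) : (z (k + 1) : ℕ).unpair.1 = (z k : ℕ).unpair.1 + 1 ∧
      IsTailImage (t (k + 1)) (t k) := by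
    have h : LevelRel (Nat.pair 0 1) (z (k + 1)) (z k) :=
      (hf _ _).2 (Or.inl (by simpa using isTailImage_zero))
    rcases h with h | ⟨h1, h2⟩
    · rwa [ht, ht] at h
    -- The edge cannot be the loop: zero vectors of different levels have different images.
    · have := congrArg (fun x : nodeSets S => (x : ℕ).unpair.1)
        (f.injective (Subtype.ext (h1.trans h2.symm)))
      simp at this
  have hlevel (k : ℕ) : (z k : ℕ).unpair.1 = k := by
    induction k with
    | zero => simp [h0]
    | succ k ih => rw [(hsucc k).1, ih]
  refine ⟨by rw [← ht 0]; exact (congrArg (fun x : ℕ => x.unpair.2) h0).trans (by simp),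
    fun k => (hsucc k).2, fun k i hi => ?_⟩
  have := (z k).2 i
  rw [ht, hlevel] at this
  exact this (lt_of_testBit hi) hi

open Classical in
/-- A code in the finite set coded by `x` whose tail has code `c`, if there is one. -/
def nextCode (x c : ℕ) : ℕ :=
  Nat.findGreatest (fun i => x.testBit i = true ∧ tailCode i = c) x

theorem primrec_nextCode : Primrec₂ nextCode := by
  classical
  refine Primrec.nat_findGreatest (p := fun (q : ℕ × ℕ) i =>
    q.1.testBit i = true ∧ tailCode i = q.2) Primrec.fst ?_
  exact .and (Primrec.eq.comp (primrec_testBit.comp (Primrec.fst.comp Primrec.fst) Primrec.snd)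
      (Primrec.const true))
    (Primrec.eq.comp (primrec_tailCode.comp Primrec.snd) (Primrec.snd.comp Primrec.fst))

/-- A node of `y` has an odd number of children in `x`, hence at least one. -/
theorem nextCode_spec {x y c : ℕ} (h : IsTailImage x y) (hc : y.testBit c = true) :
    x.testBit (nextCode x c) = true ∧ tailCode (nextCode x c) = c := by
  classical
  rw [h c] at hc
  obtain ⟨i, hi, hic⟩ := exists_of_parityBelow hc
  exact Nat.findGreatest_spec (P := fun i => x.testBit i = true ∧ tailCode i = c)
    (lt_of_testBit hi).le ⟨hi, of_decide_eq_true hic⟩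

theorem branch_of_levels {S : List ℕ → Prop} {t q : ℕ → ℕ} (h0 : t 0 = 1)
    (himage : ∀ k, IsTailImage (t (k + 1)) (t k))
    (hnode : ∀ k i, (t k).testBit i = true →
      (ofNat (List ℕ) i).length = k ∧ S (ofNat (List ℕ) i).reverse)
    (hq0 : q 0 = 0) (hq : ∀ k, q (k + 1) = nextCode (t (k + 1)) (q k)) (k : ℕ) :
    S ((List.range k).map fun x => (ofNat (List ℕ) (q (x + 1))).headI) := by
  have hbit (k : ℕ) : (t k).testBit (q k) = true := by
    induction k with
    | zero => simp [h0, hq0]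
    | succ k ih => rw [hq]; exact (nextCode_spec (himage k) ih).1
  -- Nodes are stored reversed, so the parent is the tail and the head is the newest entry of the
  -- branch.
  have hrev (k : ℕ) : (List.range k).map (fun x => (ofNat (List ℕ) (q (x + 1))).headI) =
      (ofNat (List ℕ) (q k)).reverse := by
    induction k with
    | zero =>
      rw [List.length_eq_zero_iff.1 (hnode 0 _ (hbit 0)).1]
      rfl
    | succ k ih =>
      have htail : tailCode (q (k + 1)) = q k := by
        rw [hq]; exact (nextCode_spec (himage k) (hbit k)).2
      have hlen := (hnode _ _ (hbit (k + 1))).1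
      rw [List.range_succ, List.map_append, ih, ← htail, tailCode, ofNat_encode,
        List.map_singleton]
      generalize ofNat (List ℕ) (q (k + 1)) = l at hlen
      cases l with
      | nil => cases hlen
      | cons a l => simp
  rw [hrev]
  exact (hnode k _ (hbit k)).2

theorem computesBranches_of_isomorphisms {D : Set ℕ} {F : ℕ → ℕ → ℕ → ℕ}
    (hF : ComputableIn {charFun D} (fun q : ℕ × ℕ × ℕ => F q.1 q.2.1 q.2.2))
    (h : ∀ (i j : ℕ) (s : Signature) (A B : Set ℕ) [s.lang.Structure A] [s.lang.Structure B],
      IsStructureIndex i s A → IsStructureIndex j s B → Nonempty (A ≃[s.lang] B) →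
        ∃ g : A ≃[s.lang] B, ∀ x : A, (g x : ℕ) = F i j (x : ℕ)) :
    ComputesBranches D := by
  intro R hR
  obtain ⟨a, ha, hidx⟩ := exists_binaryStructure_index (primrecRel_nodeSets hR)
    primrecPred_levelRel
  let t : ℕ → ℕ → ℕ := fun e k =>
    (F (a e (Nat.pair 0 0)) (a e (Nat.pair 0 1)) (Nat.pair k 0)).unpair.2
  -- The ascent starts at `0`, the code of the root. Each step searches a finite set given by `F`,
  -- so `q` is total and `D`-computable even when there is no branch.
  let q : ℕ → ℕ → ℕ := fun e k => Nat.rec 0 (fun y i => nextCode (t e (y + 1)) i) k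
  have ht : ComputableIn {charFun D} fun p : ℕ × ℕ => t p.1 p.2 :=
    (Primrec.snd.comp Primrec.unpair).computableIn.comp (hF.comp
      (g := fun p : ℕ × ℕ => (a p.1 (Nat.pair 0 0), a p.1 (Nat.pair 0 1), Nat.pair p.2 0))
      ((ha.comp Primrec.fst (Primrec.const _)).pair ((ha.comp Primrec.fst (Primrec.const _)).pair
        (Primrec₂.natPair.comp Primrec.snd (Primrec.const 0)))).computableIn)
  have hq : ComputableIn {charFun D} fun p : ℕ × ℕ => q p.1 p.2 :=
    ComputableIn.nat_rec (f := fun _ => 0) (h := fun r => nextCode (t r.1 (r.2.1 + 1)) r.2.2)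
      (.const 0) (ComputableIn.comp (f := fun p : ℕ × ℕ => nextCode p.1 p.2)
        (g := fun r : ℕ × ℕ × ℕ => (t r.1 (r.2.1 + 1), r.2.2)) primrec_nextCode.computableIn
        ((ht.comp (g := fun r : ℕ × ℕ × ℕ => (r.1, r.2.1 + 1)) (Primrec.fst.pair
          (Primrec.succ.comp (Primrec.fst.comp Primrec.snd))).computableIn).pair
          (Primrec.snd.comp Primrec.snd).computableIn))
  refine ⟨fun e k => (ofNat (List ℕ) (q e (k + 1))).headI, ?_, fun e ⟨g, hg⟩ => ?_⟩
  · exact (Primrec.list_headI.comp (Primrec.ofNat (List ℕ))).computableIn.comp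
      (hq.comp (g := fun p : ℕ × ℕ => (p.1, p.2 + 1))
        (Primrec.fst.pair (Primrec.succ.comp Primrec.snd)).computableIn)
  · obtain ⟨f, hf⟩ := @h _ _ binarySignature _ _
      (binaryStructure (nodeSets (R e)) (LevelRel (Nat.pair 0 0)))
      (binaryStructure (nodeSets (R e)) (LevelRel (Nat.pair 0 1)))
      (hidx e (Nat.pair 0 0)) (hidx e (Nat.pair 0 1))
      ⟨equivBinaryStructure (translateEquiv hg) fun x y => levelRel_translate g x y⟩
    obtain ⟨h0, himage, hnode⟩ := level_of_preserves (t := t e) (binaryStructureBijection f)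
      (rel_binaryStructureBijection_iff f) fun k => congrArg (fun x : ℕ => x.unpair.2) (hf _)
    exact branch_of_levels h0 himage hnode rfl fun _ => rfl

end LoquaciousHighness

end

open LoquaciousHighness in
theorem mainTheorem3 (d : LoquaciousHighness.Degree) :
    LoquaciousHighness.LoquaciouslyHighForPaths d ↔
      LoquaciousHighness.LoquaciouslyHighForIsomorphism d := by
  constructor
  · rintro ⟨D, hD, F, hF, h⟩
    exact ⟨D, hD, exists_isomorphisms_of_computesBranches (computesBranches_of_paths hF h)⟩
  · rintro ⟨D, hD, F, hF, h⟩
    exact ⟨D, hD, exists_paths_of_computesBranches (computesBranches_of_isomorphisms hF h)⟩
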